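/- Let $\Gamma$ be an infinite set, and let $2^\Gamma$ be the Cantor cube, i.e. the compact space of all functions $\Gamma\to\{0,1\}$ with the topology of pointwise convergence. Let $C(2^\Gamma)$ be the Banach space of all continuous functions $2^\Gamma\to\mathbb{R}$ with the supremum norm, let ${\rm Bo}(C(2^\Gamma))$ be the $\sigma$-algebra on $C(2^\Gamma)$ generated by the norm-open sets, and let ${\rm Ba}(C_p(2^\Gamma))$ be the Baire $\sigma$-algebra of $C(2^\Gamma)$ equipped with the topology of pointwise convergence on $2^\Gamma$, i.e. the smallest $\sigma$-algebra on $C(2^\Gamma)$ for which every real-valued function on $C(2^\Gamma)$ that is continuous in the topology of pointwise convergence is measurable. Let $C(2^\Gamma,2)\subset C(2^\Gamma)$ be the set of all $\{0,1\}$-valued continuous functions on $2^\Gamma$, and let $${\rm Ba}(C_p(2^\Gamma,2))=\{A\cap C(2^\Gamma,2): A\in{\rm Ba}(C_p(2^\Gamma))\}$$ be the trace of ${\rm Ba}(C_p(2^\Gamma))$ on it. Let ${\rm Clop}(2^\Gamma)$ be the Boolean algebra of all clopen subsets of $2^\Gamma$. Write $\mathcal{P}(X)$ for the power set of a set $X$.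 A cardinal $\kappa$ is called a Kunen cardinal if $\mathcal{P}(\kappa\times\kappa)=\mathcal{P}(\kappa)\otimes\mathcal{P}(\kappa)$, i.e. if the $\sigma$-algebra on $\kappa\times\kappa$ generated by all products $A\times B$ with $A,B\subset\kappa$ contains every subset of $\kappa\times\kappa$. Then the following statements are equivalent: (i) $|\Gamma|$ is a Kunen cardinal. (ii) ${\rm Ba}(C_p(2^\Gamma))={\rm Bo}(C(2^\Gamma))$. (iii) ${\rm Ba}(C_p(2^\Gamma,2))=\mathcal{P}(C(2^\Gamma,2))$. (iv) The $\sigma$-algebra on ${\rm Clop}(2^\Gamma)$ generated by all ultrafilters of the Boolean algebra ${\rm Clop}(2^\Gamma)$ (each regarded as a subset of ${\rm Clop}(2^\Gamma)$) is $\mathcal{P}({\rm Clop}(2^\Gamma))$. -/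

import Mathlib

universe u

/-- A cardinal `κ` is a Kunen cardinal if `𝒫(κ × κ) = 𝒫(κ) ⊗ 𝒫(κ)`: the σ-algebra on `κ × κ`
generated by all rectangles `A ×ˢ B`, with `A, B` arbitrary subsets of `κ`, consists of all
subsets of `κ × κ`. Here `κ` is represented by the type `κ.out` of cardinality `κ`. -/
def IsKunenCardinal (κ : Cardinal.{u}) : Prop :=
  MeasurableSpace.generateFrom {S : Set (κ.out × κ.out) | ∃ A B : Set κ.out, S = A ×ˢ B} = ⊤

/-- The Baire σ-algebra `Ba(T)` of a topological space `T`: the smallest σ-algebra for which all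
continuous real-valued functions on `T` are measurable. -/
abbrev baireSigmaAlgebra (T : Type u) (t : TopologicalSpace T) : MeasurableSpace T :=
  ⨆ f : {g : T → ℝ // @Continuous T ℝ t inferInstance g}, (borel ℝ).comap f.1

/-- The topology of pointwise convergence on the set `C(K)` of continuous real-valued functions
on `K`; the resulting topological space is `C_p(K)`. -/
abbrev pointwiseTopology (K : Type u) [TopologicalSpace K] : TopologicalSpace C(K, ℝ) :=
  TopologicalSpace.induced (fun (f : C(K, ℝ)) (x : K) => f x) Pi.topologicalSpace

/-- The σ-algebra `Ba(C_p(K))` on `C(K)`. -/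
abbrev baireCp (K : Type u) [TopologicalSpace K] : MeasurableSpace C(K, ℝ) :=
  baireSigmaAlgebra C(K, ℝ) (pointwiseTopology K)

/-- The topology of the supremum norm on `C(K)`, for `K` compact. -/
noncomputable abbrev supNormTopology (K : Type u) [TopologicalSpace K] [CompactSpace K] :
    TopologicalSpace C(K, ℝ) :=
  (inferInstance : NormedAddCommGroup C(K, ℝ)).toMetricSpace.toUniformSpace.toTopologicalSpace

/-- The σ-algebra `Bo(C(K))` on `C(K)`, generated by the norm-open sets. -/
noncomputable abbrev borelC (K : Type u) [TopologicalSpace K] [CompactSpace K] : MeasurableSpace C(K, ℝ) :=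
  @borel C(K, ℝ) (supNormTopology K)

/-- The subset `C(K, 2)` of `C(K)` of all `{0,1}`-valued continuous functions. -/
def zeroOneFunctions (K : Type u) [TopologicalSpace K] : Set C(K, ℝ) :=
  {f | ∀ x : K, f x = 0 ∨ f x = 1}

/-- The trace of a σ-algebra `m` on `S`, as a σ-algebra on the subtype `S`: its members are the
sets `S ∩ A` with `A` in `m`. -/
abbrev traceSigmaAlgebra {Y : Type u} (m : MeasurableSpace Y) (S : Set Y) : MeasurableSpace S :=
  m.comap Subtype.val

/-- An ultrafilter of a Boolean algebra: a maximal element among the filters that do not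
contain `⊥`. -/
def IsBooleanUltrafilter {B : Type u} [BooleanAlgebra B] (F : Order.PFilter B) : Prop :=
  Maximal (fun G : Order.PFilter B => ⊥ ∉ G) F

/-- The σ-algebra on a Boolean algebra `B` generated by all ultrafilters of `B`, each of them
regarded as a subset of `B`. -/
abbrev ultrafilterSigmaAlgebra (B : Type u) [BooleanAlgebra B] : MeasurableSpace B :=
  MeasurableSpace.generateFrom
    {S : Set B | ∃ F : Order.PFilter B, IsBooleanUltrafilter F ∧ S = (F : Set B)}

/-!
The implications are proved in a cycle. Write `K = Γ → Bool` and, for `f ∈ C(K)` and `I ⊆ Γ`, let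
`osc(f, I)` be the supremum of `|f x - f y|` over all `x`, `y` that agree off `I`.

**(i) ⟹ (ii).** Pointwise continuous functions are norm continuous, so the point is that norm-open
sets are Baire; in fact they belong to the `σ`-algebra generated by the evaluations. By (i), every
subset of `Γ × Γ` is determined by countably many subsets of `Γ`; applied to the diagonal this gives
countably many sets separating the points of `Γ`. Hence `K` is separable, and so `f ↦ osc(f, I)` is
measurable for *every* `I ⊆ Γ` (`measurableSet_oscLE`): this is what allows arbitrary subsets of
`Γ` to be tested. If `osc(f, W) > 2η` and `osc(f, W \ {γ}) ≤ η` for some `γ ∈ W`, then `γ` is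
unique, and `γ ∈ B` if and only if `osc(f, W \ B) ≤ η`; so `γ` is a function of `f` that is
measurable for the discrete `σ`-algebra on `Γ` (`measurable_isolatedCoord`). Each `f` depends up to
`ε` on finitely many coordinates, which are isolated in this way by members of a countable family
of sets `W`, so `f` is uniformly close to a function of these coordinates with rational values
(`exists_isApproxData`). By (i), tuples of such coordinates are measurable for the discrete
`σ`-algebra on `Γⁿ` as well (`measurable_pi_top`), and this exhibits a norm-open set as a countable
union of measurable sets.

**(ii) ⟹ (iii).** Distinct `{0,1}`-valued functions have distance `1`, so every set of such
functions is norm closed.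

**(iii) ⟹ (iv).** The ultrafilters of clopen sets correspond to the points of `K`. The clopen sets
form a dense subspace of the power `{0,1}^K`, which satisfies the countable chain condition. Thus
closures of open sets in `{0,1}^K` depend on countably many coordinates, and pointwise continuous
functions on the clopen algebra are measurable for the `σ`-algebra generated by the ultrafilters.

**(iv) ⟹ (i).** Split `Γ` into two copies of itself. The map sending `(γ, δ)` to the clopen set of
all `x` with `x γ = 1` in the first copy and `x δ = 1` in the second one is injective, and the
preimages of ultrafilters are rectangles.
-/

open Set Filter Topology MeasureTheory TopologicalSpace


/-! ### Continuous functions on dense subspaces of a power of `Bool` -/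

/-- The fair coin measure on `Bool`. -/
noncomputable abbrev fairCoin : Measure Bool := ProbabilityTheory.uniformOn univ

instance : IsProbabilityMeasure fairCoin :=
  ProbabilityTheory.isProbabilityMeasure_uniformOn finite_univ univ_nonempty

theorem fairCoin_singleton_ne_zero (b : Bool) : fairCoin {b} ≠ 0 := by
  rw [Ne, ProbabilityTheory.uniformOn_eq_zero_iff finite_univ]
  simp

/-- Powers of `Bool` satisfy the countable chain condition, since the fair coin tossing measure is
positive on every nonempty basic clopen set. -/
theorem countable_of_pairwiseDisjoint_cylinders {ι : Type*} {𝒜 : Set (Set (ι → Bool))}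
    (hcyl : ∀ C ∈ 𝒜, ∃ (F : Finset ι) (x : ι → Bool), C = (F : Set ι).pi fun i => {x i})
    (hdisj : 𝒜.PairwiseDisjoint id) : 𝒜.Countable := by
  have hms : ∀ C ∈ 𝒜, MeasurableSet C := by
    rintro C hC
    obtain ⟨F, x, rfl⟩ := hcyl C hC
    exact MeasurableSet.pi F.countable_toSet fun i _ => measurableSet_singleton _
  have hpos : ∀ C ∈ 𝒜, 0 < Measure.infinitePi (fun _ : ι => fairCoin) C := by
    rintro C hC
    obtain ⟨F, x, rfl⟩ := hcyl C hC
    rw [Measure.infinitePi_pi _ fun i _ => measurableSet_singleton _, pos_iff_ne_zero,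
      Finset.prod_ne_zero_iff]
    exact fun i _ => fairCoin_singleton_ne_zero _
  have := Measure.countable_meas_pos_of_disjoint_iUnion
    (μ := Measure.infinitePi (fun _ : ι => fairCoin)) (As := fun C : 𝒜 => (C : Set (ι → Bool)))
    (fun C => hms C C.2) (fun C D hCD => hdisj C.2 D.2 (fun h => hCD (Subtype.ext h)))
  rw [← countable_coe_iff, ← countable_univ_iff]
  exact this.mono fun C _ => hpos C C.2

theorem exists_cylinder_subset {ι : Type*} {W : Set (ι → Bool)} (hW : IsOpen W) {x : ι → Bool}
    (hx : x ∈ W) : ∃ F : Finset ι, (F : Set ι).pi (fun i => {x i}) ⊆ W := by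
  obtain ⟨F, u, hu, hsub⟩ := isOpen_pi_iff.1 hW x hx
  exact ⟨F, (pi_mono fun i hi => singleton_subset_iff.2 (hu i hi).2).trans hsub⟩

theorem isOpen_cylinder {ι : Type*} (F : Finset ι) (x : ι → Bool) :
    IsOpen ((F : Set ι).pi fun i => {x i}) :=
  isOpen_set_pi F.finite_toSet fun _ _ => isOpen_discrete _

/-- The closure of an open set in a power of `Bool` depends on countably many coordinates, as an
open set contains a dense countable union of basic clopen sets. -/
theorem measurableSet_closure_of_isOpen {ι : Type*} {W : Set (ι → Bool)} (hW : IsOpen W) :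
    MeasurableSet (closure W) := by
  classical
  -- A maximal disjoint family of cylinders contained in `W` has dense union in `W`.
  let 𝒮 : Set (Set (Set (ι → Bool))) :=
    {𝒜 | (∀ C ∈ 𝒜, C ⊆ W ∧ ∃ (F : Finset ι) (x : ι → Bool),
      C = (F : Set ι).pi fun i => {x i}) ∧ 𝒜.PairwiseDisjoint id}
  obtain ⟨𝒜, h𝒜⟩ := zorn_subset 𝒮 (by
    intro c hc hchain
    refine ⟨⋃₀ c, ⟨?_, ?_⟩, fun s hs => subset_sUnion_of_mem hs⟩
    · rintro C ⟨s, hs, hC⟩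
      exact (hc hs).1 C hC
    · exact (pairwiseDisjoint_sUnion hchain.directedOn).2 fun s hs => (hc hs).2)
  obtain ⟨⟨hcyl, hdisj⟩, hmax⟩ := h𝒜
  have hcount := countable_of_pairwiseDisjoint_cylinders (fun C hC => (hcyl C hC).2) hdisj
  have hVW : ⋃₀ 𝒜 ⊆ W := sUnion_subset fun C hC => (hcyl C hC).1
  have hdense : W ⊆ closure (⋃₀ 𝒜) := by
    intro x hx
    by_contra hxV
    obtain ⟨F, hF⟩ := exists_cylinder_subset (hW.inter isClosed_closure.isOpen_compl) ⟨hx, hxV⟩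
    set C := (F : Set ι).pi fun i => {x i} with hC
    have hxC : x ∈ C := fun i _ => rfl
    have hins : insert C 𝒜 ∈ 𝒮 := by
      refine ⟨?_, ?_⟩
      · rintro D (rfl | hD)
        · exact ⟨hF.trans inter_subset_left, F, x, rfl⟩
        · exact hcyl D hD
      · refine hdisj.insert fun D hD _ => ?_
        refine disjoint_left.2 fun y hy hyD => (hF hy).2 (subset_closure ⟨D, hD, hyD⟩)
    have : C ∈ 𝒜 := hmax hins (subset_insert _ _) (mem_insert _ _)
    exact (hF hxC).2 (subset_closure ⟨C, this, hxC⟩)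
  have hcl : closure W = closure (⋃₀ 𝒜) :=
    Subset.antisymm (closure_minimal hdense isClosed_closure) (closure_mono hVW)
  have : ∀ C : 𝒜, ∃ F : Finset ι, ∃ x : ι → Bool, (C : Set (ι → Bool)) =
      (F : Set ι).pi fun i => {x i} := fun C => (hcyl C C.2).2
  choose F x hFx using this
  have : Countable 𝒜 := hcount.to_subtype
  -- The union of the family, hence its closure, is a preimage under the projection to the
  -- countable set `J` of coordinates involved.
  let J : Set ι := ⋃ C : 𝒜, (F C : Set ι)
  have hJ : J.Countable := countable_iUnion fun C => (F C).countable_toSet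
  have : Countable J := hJ.to_subtype
  let p : (ι → Bool) → (J → Bool) := fun y j => y j
  have hpc : Continuous p := by fun_prop
  have hp : IsOpenMap p := by
    refine isOpenMap_iff_nhds_le.2 fun y => ?_
    refine (Filter.le_map_iff).2 fun s hs => ?_
    obtain ⟨G, hG⟩ := exists_cylinder_subset isOpen_interior (mem_interior_iff_mem_nhds.2 hs)
    have ho : IsOpen ((G.subtype (· ∈ J) : Set J).pi fun i => ({y i} : Set Bool)) :=
      isOpen_cylinder _ fun i : J => y i
    refine mem_of_superset (ho.mem_nhds fun i _ => rfl) fun z hz => ?_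
    refine ⟨fun i => if h : i ∈ J then z ⟨i, h⟩ else y i,
      interior_subset (hG fun i hi => ?_), ?_⟩
    · by_cases h : i ∈ J
      · simpa [h] using hz ⟨i, h⟩ (by simpa using hi)
      · simp [h]
    · ext j
      simp [p]
  have hsat : ⋃₀ 𝒜 = p ⁻¹' (p '' ⋃₀ 𝒜) := by
    refine Subset.antisymm (subset_preimage_image _ _) ?_
    rintro y ⟨z, ⟨C, hC, hz⟩, hzy⟩
    refine ⟨C, hC, ?_⟩
    rw [show C = _ from hFx ⟨C, hC⟩] at hz ⊢
    intro i hi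
    have : z i = y i := congrFun hzy ⟨i, mem_iUnion.2 ⟨⟨C, hC⟩, hi⟩⟩
    rw [← this]
    exact hz i hi
  rw [hcl, hsat, ← hp.preimage_closure_eq_closure_preimage hpc]
  have hpm : Measurable p := measurable_pi_lambda _ fun j => measurable_pi_apply _
  exact hpm isClosed_closure.measurableSet

/-- A continuous real function on a dense subspace of a power of `Bool` is measurable for the
`σ`-algebra generated by the coordinates: `{g > a}` is the union of the closures of the sets
`{g > a + 1 / (n + 1)}`. -/
theorem Topology.IsInducing.measurable_comap_of_continuous {Y ι : Type*} [TopologicalSpace Y]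
    {φ : Y → ι → Bool} (hφ : IsInducing φ) (hd : DenseRange φ) {g : Y → ℝ} (hg : Continuous g) :
    @Measurable Y ℝ (MeasurableSpace.comap φ inferInstance) _ g := by
  have hcl : ∀ O : Set Y, IsOpen O →
      MeasurableSet[MeasurableSpace.comap φ inferInstance] (closure O) := by
    intro O hO
    obtain ⟨W, hW, rfl⟩ := hφ.isOpen_iff.1 hO
    refine ⟨closure W, measurableSet_closure_of_isOpen hW, ?_⟩
    rw [hφ.closure_eq_preimage_closure_image, image_preimage_eq_inter_range]
    congr 1
    exact Subset.antisymm (closure_minimal (hd.open_subset_closure_inter hW) isClosed_closure)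
      (closure_mono inter_subset_left)
  let : MeasurableSpace Y := MeasurableSpace.comap φ inferInstance
  refine measurable_of_Ioi fun a => ?_
  have : g ⁻¹' Ioi a = ⋃ n : ℕ, closure (g ⁻¹' Ioi (a + 1 / ((n : ℝ) + 1))) := by
    refine Subset.antisymm (fun y hy => ?_) (iUnion_subset fun n => ?_)
    · obtain ⟨n, hn⟩ := exists_nat_one_div_lt (sub_pos.2 (show a < g y from hy))
      exact mem_iUnion.2 ⟨n, subset_closure (show a + _ < g y by linarith)⟩
    · refine (closure_minimal (t := g ⁻¹' Ici (a + 1 / ((n : ℝ) + 1)))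
        (preimage_mono Ioi_subset_Ici_self) (isClosed_Ici.preimage hg)).trans fun y hy => ?_
      have : (0 : ℝ) < 1 / ((n : ℝ) + 1) := by positivity
      exact lt_of_lt_of_le (by linarith) (show a + 1 / ((n : ℝ) + 1) ≤ g y from hy)
  rw [this]
  exact MeasurableSet.iUnion fun n => hcl _ (isOpen_Ioi.preimage hg)

/-! ### Ultrafilters of clopen sets -/

section PointFilters

variable {K : Type*} [TopologicalSpace K]

/-- The filter of all clopen sets containing a given point. -/
def clopenPointFilter (x : K) : Order.PFilter (Clopens K) :=
  Order.IsPFilter.toPFilter (F := {a : Clopens K | x ∈ a})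
    (Order.IsPFilter.of_def ⟨⊤, trivial⟩
      (fun a ha b hb => ⟨a ⊓ b, ⟨ha, hb⟩, inf_le_left, inf_le_right⟩)
      (fun h ha => h ha))

theorem isBooleanUltrafilter_clopenPointFilter (x : K) :
    IsBooleanUltrafilter (clopenPointFilter x) := by
  refine ⟨fun h => h, fun G hG hle a ha => ?_⟩
  by_contra hx
  have : aᶜ ∈ G := hle (show aᶜ ∈ clopenPointFilter x from hx)
  have := Order.PFilter.inf_mem ha this
  rw [inf_compl_self] at this
  exact hG this

/-- By compactness every ultrafilter of clopen sets consists of the clopen neighbourhoods of a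
point. -/
theorem IsBooleanUltrafilter.exists_eq_clopenPointFilter [CompactSpace K]
    {F : Order.PFilter (Clopens K)} (hF : IsBooleanUltrafilter F) :
    ∃ x, F = clopenPointFilter x := by
  have hne : (⋂ a : {a : Clopens K // a ∈ F}, (a.1 : Set K)).Nonempty := by
    refine CompactSpace.iInter_nonempty (fun a => a.1.isClopen.isClosed) fun s => ?_
    have : s.inf (fun a => a.1) ∈ F := by
      induction s using Finset.cons_induction with
      | empty => exact Order.PFilter.top_mem
      | cons a s ha ih =>
        rw [Finset.inf_cons]
        exact Order.PFilter.inf_mem a.2 ih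
    have hb : s.inf (fun a => a.1) ≠ ⊥ := fun h => hF.1 (h ▸ this)
    have : ((s.inf (fun a => a.1) : Clopens K) : Set K).Nonempty := by
      rw [nonempty_iff_ne_empty]
      exact fun h => hb (SetLike.coe_injective h)
    refine this.mono fun y hy => mem_iInter₂.2 fun a ha => ?_
    exact (Finset.inf_le ha : s.inf (fun a => a.1) ≤ a.1) hy
  obtain ⟨x, hx⟩ := hne
  have hle : F ≤ clopenPointFilter x := fun a ha => mem_iInter.1 hx ⟨a, ha⟩
  exact ⟨x, le_antisymm hle (hF.2 (isBooleanUltrafilter_clopenPointFilter x).1 hle)⟩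

end PointFilters

theorem ultrafilterSigmaAlgebra_clopens (K : Type u) [TopologicalSpace K] [CompactSpace K] :
    ultrafilterSigmaAlgebra (Clopens K) =
      MeasurableSpace.generateFrom (range fun x : K => {a : Clopens K | x ∈ a}) := by
  refine congrArg MeasurableSpace.generateFrom (Set.ext fun S => ?_)
  constructor
  · rintro ⟨F, hF, rfl⟩
    obtain ⟨x, rfl⟩ := hF.exists_eq_clopenPointFilter
    exact ⟨x, rfl⟩
  · rintro ⟨x, rfl⟩
    exact ⟨_, isBooleanUltrafilter_clopenPointFilter x, rfl⟩

/-- A clopen set as a `Bool`-valued function on the points of the space; this embeds the clopen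
algebra in a power of `Bool`. -/
noncomputable def clopenEval (K : Type*) [TopologicalSpace K] (a : Clopens K) (x : K) : Bool :=
  open Classical in decide (x ∈ a)

/-- Finitely many points can be separated by a clopen set from finitely many others. -/
theorem denseRange_clopenEval (K : Type*) [TopologicalSpace K] [CompactSpace K] [T2Space K]
    [TotallyDisconnectedSpace K] : DenseRange (clopenEval K) := by
  refine dense_iff_inter_open.2 fun O hO ⟨b, hb⟩ => ?_
  obtain ⟨F, hF⟩ := exists_cylinder_subset hO hb
  have hN : IsOpen {y | y ∈ F ∧ b y = false}ᶜ :=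
    (F.finite_toSet.subset fun y hy => hy.1).isClosed.isOpen_compl
  have : ∀ y : K, ∃ a : Clopens K,
      b y = true → y ∈ a ∧ (a : Set K) ⊆ {y | y ∈ F ∧ b y = false}ᶜ := by
    intro y
    by_cases hy : b y = true
    · obtain ⟨V, hV, hyV, hVN⟩ := compact_exists_isClopen_in_isOpen hN
        (show y ∈ {y | y ∈ F ∧ b y = false}ᶜ by simp [hy])
      exact ⟨⟨V, hV⟩, fun _ => ⟨hyV, hVN⟩⟩
    · exact ⟨⊥, fun h => absurd h hy⟩
  choose V hV using this
  refine ⟨clopenEval K ((F.filter fun y => b y = true).sup V), hF fun y hy => ?_, mem_range_self _⟩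
  have hmem : y ∈ (F.filter fun y => b y = true).sup V ↔ b y = true := by
    rw [← SetLike.mem_coe, Clopens.coe_finset_sup]
    simp only [mem_iUnion, Finset.mem_filter, exists_prop, SetLike.mem_coe]
    constructor
    · rintro ⟨z, ⟨_, hz⟩, hyz⟩
      by_contra hby
      exact (hV z hz).2 hyz ⟨hy, by simpa using hby⟩
    · exact fun hby => ⟨y, ⟨hy, hby⟩, (hV y hby).1⟩
  simp only [clopenEval, mem_singleton_iff, hmem, Bool.decide_eq_true]

theorem comap_clopenEval_le (K : Type u) [TopologicalSpace K] [CompactSpace K] :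
   MeasurableSpace.comap (clopenEval K) inferInstance ≤ ultrafilterSigmaAlgebra (Clopens K) := by
  rw [← measurable_iff_comap_le, ultrafilterSigmaAlgebra_clopens]
  let : MeasurableSpace (Clopens K) :=
      MeasurableSpace.generateFrom (range fun x : K => {a : Clopens K | x ∈ a})
  refine measurable_pi_lambda _ fun x => measurable_to_bool ?_
  refine MeasurableSpace.measurableSet_generateFrom ⟨x, ?_⟩
  ext a
  simp [clopenEval]

/-! ### Zero-one valued functions -/

/-- The indicator function of a clopen set. -/
noncomputable def clopenIndicator {K : Type*} [TopologicalSpace K] (a : Clopens K) : C(K, ℝ) where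
  toFun := indicator (a : Set K) 1
  continuous_toFun := a.isClopen.continuous_indicator continuous_one
theorem clopenIndicator_mem {K : Type u} [TopologicalSpace K] (a : Clopens K) :
    clopenIndicator a ∈ zeroOneFunctions K :=
  fun x => indicator_eq_zero_or_self (a : Set K) 1 x

theorem clopenEval_eq_true {K : Type*} [TopologicalSpace K] {a : Clopens K} {x : K} :
    clopenEval K a x = true ↔ x ∈ a := by
  simp [clopenEval]

theorem clopenIndicator_injective (K : Type*) [TopologicalSpace K] :
    Function.Injective (clopenIndicator (K := K)) := by
  intro a b h
  refine SetLike.coe_injective (indicator_one_inj ℝ ?_)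
  exact congrArg DFunLike.coe h

/-- A pointwise continuous function on `C(K)` restricts to a continuous function on the clopen
algebra, a dense subspace of a power of `Bool`; so the restriction is measurable for the
`σ`-algebra generated by the ultrafilters. -/
theorem measurable_clopenIndicator (K : Type u) [TopologicalSpace K] [CompactSpace K] [T2Space K]
    [TotallyDisconnectedSpace K] :
    Measurable[ultrafilterSigmaAlgebra (Clopens K), baireCp K] clopenIndicator := by
  rw [measurable_iff_comap_le, MeasurableSpace.comap_iSup]
  refine iSup_le fun ⟨g, hg⟩ => ?_
  rw [MeasurableSpace.comap_comp]
  refine le_trans ?_ (comap_clopenEval_le K)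
  rw [← measurable_iff_comap_le]
  let : TopologicalSpace (Clopens K) := TopologicalSpace.induced (clopenEval K) inferInstance
  have hind : IsInducing (clopenEval K) := ⟨rfl⟩
  refine hind.measurable_comap_of_continuous (denseRange_clopenEval K)
    (@Continuous.comp _ _ _ _ (pointwiseTopology K) _ _ _ hg ?_)
  refine continuous_induced_rng.2 (continuous_pi fun x => ?_)
  have : (fun a : Clopens K => clopenIndicator a x) =
      (fun b : Bool => if b then (1 : ℝ) else 0) ∘ fun a => clopenEval K a x := by
    ext a
    by_cases h : x ∈ a
    · simp [clopenIndicator, clopenEval_eq_true, h]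
    · simp [clopenIndicator, clopenEval_eq_true, h]
  change Continuous fun a : Clopens K => clopenIndicator a x
  rw [this]
  exact continuous_of_discreteTopology.comp ((continuous_apply x).comp hind.continuous)

theorem ultrafilterSigmaAlgebra_eq_top_of_trace_eq_top (K : Type u) [TopologicalSpace K]
    [CompactSpace K] [T2Space K] [TotallyDisconnectedSpace K]
    (h : traceSigmaAlgebra (baireCp K) (zeroOneFunctions K) = ⊤) :
    ultrafilterSigmaAlgebra (Clopens K) = ⊤ := by
  rw [eq_top_iff]
  intro T _
  obtain ⟨A, hA, hAT⟩ : MeasurableSet[traceSigmaAlgebra (baireCp K) (zeroOneFunctions K)]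
      {f | ∃ a ∈ T, clopenIndicator a = f.1} := h ▸ MeasurableSpace.measurableSet_top
  have : T = clopenIndicator ⁻¹' A := by
    ext a
    have hmem := Set.ext_iff.1 hAT ⟨clopenIndicator a, clopenIndicator_mem a⟩
    refine Iff.trans ?_ hmem.symm
    exact ⟨fun ha => ⟨a, ha, rfl⟩, fun ⟨b, hb, hba⟩ => clopenIndicator_injective K hba ▸ hb⟩
  rw [this]
  exact measurable_clopenIndicator K hA

/-- Any set of `{0,1}`-valued functions is norm closed, as the distance of two of them is `1`. -/
theorem trace_eq_top_of_baireCp_eq_borelC (K : Type u) [TopologicalSpace K] [CompactSpace K]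
    (h : baireCp K = borelC K) : traceSigmaAlgebra (baireCp K) (zeroOneFunctions K) = ⊤ := by
  rw [eq_top_iff]
  intro S _
  refine ⟨Subtype.val '' S, ?_, preimage_image_eq S Subtype.val_injective⟩
  rw [h]
  have hcl : IsClosed[supNormTopology K] (Subtype.val '' S) := by
    refine Metric.isClosed_of_pairwise_le_dist one_pos ?_
    rintro _ ⟨f, hf, rfl⟩ _ ⟨g, hg, rfl⟩ hfg
    obtain ⟨x, hx⟩ := DFunLike.ne_iff.1 hfg
    refine le_trans ?_ (ContinuousMap.dist_apply_le_dist x)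
    rcases f.2 x with h1 | h1 <;> rcases g.2 x with h2 | h2 <;> simp [h1, h2] at hx ⊢
  rw [← MeasurableSet.compl_iff]
  exact MeasurableSpace.measurableSet_generateFrom hcl.isOpen_compl

/-! ### Rectangles -/

/-- Pairs of coordinates embed in the clopen algebra in such a way that ultrafilters pull back to
rectangles. -/
theorem generateFrom_prod_eq_top_of_ultrafilterSigmaAlgebra_eq_top (Γ : Type u) [Infinite Γ]
    (h : ultrafilterSigmaAlgebra (Clopens (Γ → Bool)) = ⊤) :
    MeasurableSpace.generateFrom {S : Set (Γ × Γ) | ∃ A B : Set Γ, S = A ×ˢ B} = ⊤ := by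
  classical
  have hcard : Cardinal.mk (Γ ⊕ Γ) = Cardinal.mk Γ := by
    rw [Cardinal.mk_sum]; simp
  obtain ⟨e⟩ := Cardinal.eq.1 hcard
  let ψ : Γ × Γ → Clopens (Γ → Bool) := fun p =>
    ⟨{x | x (e (.inl p.1)) = true ∧ x (e (.inr p.2)) = true},
      ((isClopen_discrete {true}).preimage (continuous_apply _)).inter
        ((isClopen_discrete {true}).preimage (continuous_apply _))⟩
  have hψ : ∀ p x, x ∈ ψ p ↔ x (e (.inl p.1)) = true ∧ x (e (.inr p.2)) = true :=
    fun _ _ => Iff.rfl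
  have hinj : Function.Injective ψ := by
    intro p q hpq
    have := (hψ q fun γ => decide (γ = e (.inl p.1) ∨ γ = e (.inr p.2))).1
      (hpq ▸ (hψ p _).2 (by simp))
    simp at this
    exact Prod.ext this.1.symm this.2.symm
  rw [eq_top_iff]
  intro S _
  have hS : MeasurableSet[MeasurableSpace.comap ψ (ultrafilterSigmaAlgebra _)] S :=
    ⟨ψ '' S, h ▸ trivial, preimage_image_eq S hinj⟩
  rw [ultrafilterSigmaAlgebra_clopens, MeasurableSpace.comap_generateFrom] at hS
  refine MeasurableSpace.generateFrom_mono ?_ S hS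
  rintro _ ⟨_, ⟨x, rfl⟩, rfl⟩
  exact ⟨{γ | x (e (.inl γ)) = true}, {γ | x (e (.inr γ)) = true}, rfl⟩

theorem isKunenCardinal_mk_iff (Γ : Type u) : IsKunenCardinal (Cardinal.mk Γ) ↔
    MeasurableSpace.generateFrom {S : Set (Γ × Γ) | ∃ A B : Set Γ, S = A ×ˢ B} = ⊤ := by
  have key : ∀ {α β : Type u} (e : α ≃ β),
      MeasurableSpace.generateFrom {S : Set (α × α) | ∃ A B : Set α, S = A ×ˢ B} = ⊤ →
      MeasurableSpace.generateFrom {S : Set (β × β) | ∃ A B : Set β, S = A ×ˢ B} = ⊤ := by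
    intro α β e h
    rw [eq_top_iff]
    intro S _
    have : MeasurableSet[MeasurableSpace.comap (Prod.map e.symm e.symm)
        (MeasurableSpace.generateFrom {S : Set (α × α) | ∃ A B : Set α, S = A ×ˢ B})] S :=
      ⟨Prod.map e e ⁻¹' S, h ▸ trivial, by ext p; simp [Prod.map]⟩
    rw [MeasurableSpace.comap_generateFrom] at this
    refine MeasurableSpace.generateFrom_mono ?_ S this
    rintro _ ⟨_, ⟨A, B, rfl⟩, rfl⟩
    exact ⟨e.symm ⁻¹' A, e.symm ⁻¹' B, rfl⟩
  exact ⟨key Cardinal.outMkEquiv, key Cardinal.outMkEquiv.symm⟩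

/-! ### Countable separating families -/

/-- Every member of the `σ`-algebra generated by the rectangles is determined by countably many
sets; applied to the diagonal, this yields a countable family separating the points. -/
theorem exists_separating_of_generateFrom_prod_eq_top {Γ : Type*}
    (h : MeasurableSpace.generateFrom {S : Set (Γ × Γ) | ∃ A B : Set Γ, S = A ×ˢ B} = ⊤) :
    ∃ E : ℕ → Set Γ, ∀ a b, (∀ k, a ∈ E k ↔ b ∈ E k) → a = b := by
  have key : ∀ S : Set (Γ × Γ),
      MeasurableSet[MeasurableSpace.generateFrom {S : Set (Γ × Γ) | ∃ A B : Set Γ, S = A ×ˢ B}] S →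
      ∃ E : ℕ → Set Γ, ∀ a a' b, (∀ k, a ∈ E k ↔ a' ∈ E k) → ((a, b) ∈ S ↔ (a', b) ∈ S) := by
    intro S hS
    induction S, hS using MeasurableSpace.generateFrom_induction with
    | hC S hS _ =>
      obtain ⟨A, B, rfl⟩ := hS
      exact ⟨fun _ => A, fun a a' b hE => by simp [hE 0]⟩
    | empty => exact ⟨fun _ => ∅, by simp⟩
    | compl S _ ih =>
      obtain ⟨E, hE⟩ := ih
      exact ⟨E, fun a a' b h => not_congr (hE a a' b h)⟩
    | iUnion S _ ih =>
      choose E hE using ih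
      refine ⟨fun k => E k.unpair.1 k.unpair.2, fun a a' b h => ?_⟩
      simp only [mem_iUnion]
      refine exists_congr fun n => hE n a a' b fun k => ?_
      simpa using h (Nat.pair n k)
  obtain ⟨E, hE⟩ := key (diagonal Γ) (h ▸ trivial)
  exact ⟨E, fun a b hab => ((hE a b a hab).1 rfl).symm⟩

/-! ### Maps measurable for the discrete `σ`-algebra -/

section Tuples

variable {X : Type*} {m : MeasurableSpace X} {Γ : Type*}

/-- Pairs of discretely measurable maps are discretely measurable, if their targets embed in
`Γ`. -/
theorem measurable_prodMk_top
    (h : MeasurableSpace.generateFrom {S : Set (Γ × Γ) | ∃ A B : Set Γ, S = A ×ˢ B} = ⊤)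
    {α β : Type*} {i : α → Γ} {j : β → Γ} (hi : Function.Injective i) (hj : Function.Injective j)
    {f : X → α} {g : X → β} (hf : Measurable[m, ⊤] f) (hg : Measurable[m, ⊤] g) :
    Measurable[m, ⊤] fun x => (f x, g x) := by
  have hpair : Measurable[m, ⊤] fun x => (i (f x), j (g x)) := by
    rw [← h]
    refine measurable_generateFrom ?_
    rintro _ ⟨A, B, rfl⟩
    have h1 : MeasurableSet (f ⁻¹' (i ⁻¹' A)) := hf trivial
    have h2 : MeasurableSet (g ⁻¹' (j ⁻¹' B)) := hg trivial
    exact h1.inter h2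
  intro T _
  have : MeasurableSet ((fun x => (i (f x), j (g x))) ⁻¹' (Prod.map i j '' T)) := hpair trivial
  convert this using 1
  rw [show (fun x => (i (f x), j (g x))) = Prod.map i j ∘ fun x => (f x, g x) from rfl,
    preimage_comp, preimage_image_eq _ (hi.prodMap hj)]

/-- If all subsets of `Γ × Γ` belong to the product `σ`-algebra, then maps into a finite power of
`Γ` are measurable for the discrete `σ`-algebra as soon as their coordinates are. -/
theorem measurable_pi_top [Infinite Γ]
    (h : MeasurableSpace.generateFrom {S : Set (Γ × Γ) | ∃ A B : Set Γ, S = A ×ˢ B} = ⊤)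
    {n : ℕ} {g : Fin n → X → Γ} (hg : ∀ i, Measurable[m, ⊤] (g i)) :
    Measurable[m, ⊤] fun x i => g i x := by
  induction n with
  | zero =>
    intro T _
    have : (fun x (i : Fin 0) => g i x) = fun _ => Fin.elim0 :=
      funext fun x => Subsingleton.elim _ _
    rw [this]
    exact MeasurableSet.const _
  | succ n ih =>
    have hcard : Cardinal.mk (Fin n → Γ) ≤ Cardinal.mk Γ := by
      simpa using Cardinal.power_nat_le (n := n) (Cardinal.aleph0_le_mk Γ)
    obtain ⟨j⟩ := Cardinal.le_def _ _ |>.1 hcard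
    have hpair := measurable_prodMk_top h Function.injective_id j.injective (hg 0)
      (ih fun i => hg i.succ)
    intro T _
    have : MeasurableSet ((fun x => (g 0 x, fun i : Fin n => g i.succ x)) ⁻¹'
        {p | (Fin.cons p.1 p.2 : Fin (n + 1) → Γ) ∈ T}) := hpair trivial
    convert this using 1
    ext x
    have hx : (fun i => g i x) = (Fin.cons (g 0 x) fun i : Fin n => g i.succ x :
        Fin (n + 1) → Γ) := (Fin.cons_self_tail fun i => g i x).symm
    simp only [mem_preimage, mem_ofPred_eq, ← hx]

end Tuples

/-! ### Cells of a countable separating family -/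

/-- The trace of `γ` on the first `m` members of a sequence of sets, coded by the set of the
indices `k < m` with `γ ∈ E k`. Its fibres are the cells of the partition generated by
`E 0, …, E (m - 1)`. -/
noncomputable def cellCode {Γ : Type*} (E : ℕ → Set Γ) (m : ℕ) (γ : Γ) : Finset ℕ :=
  open Classical in (Finset.range m).filter fun k => γ ∈ E k

section Cells

variable {Γ : Type*} {E : ℕ → Set Γ}

theorem cellCode_eq_iff {m : ℕ} {γ γ' : Γ} :
    cellCode E m γ = cellCode E m γ' ↔ ∀ k < m, γ ∈ E k ↔ γ' ∈ E k := by
  simp [cellCode, Finset.ext_iff]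

theorem cellCode_eq_of_le {m m' : ℕ} (hm : m ≤ m') {γ γ' : Γ}
    (h : cellCode E m' γ = cellCode E m' γ') : cellCode E m γ = cellCode E m γ' :=
  cellCode_eq_iff.2 fun k hk => cellCode_eq_iff.1 h k (hk.trans_le hm)

theorem exists_cellCode_injOn (hE : ∀ a b, (∀ k, a ∈ E k ↔ b ∈ E k) → a = b) (F : Finset Γ) :
    ∃ m, InjOn (cellCode E m) F := by
  have : ∀ p : Γ × Γ, ∃ k, p.1 ≠ p.2 → ¬(p.1 ∈ E k ↔ p.2 ∈ E k) := by
    intro p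
    by_contra! hk
    exact (hk 0).1 (hE _ _ fun k => (hk k).2)
  choose k hk using this
  refine ⟨(F ×ˢ F).sup k + 1, fun a ha b hb hab => ?_⟩
  by_contra hne
  refine hk (a, b) hne (cellCode_eq_iff.1 hab _ (Nat.lt_succ_of_le ?_))
  exact Finset.le_sup (f := k) (Finset.mem_product.2 ⟨ha, hb⟩)

/-- A Cantor cube is separable if countably many sets separate its coordinates: the points that
are constant on the cells of some level are dense. -/
theorem separableSpace_pi_bool (hE : ∀ a b, (∀ k, a ∈ E k ↔ b ∈ E k) → a = b) :
    SeparableSpace (Γ → Bool) := by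
  classical
  let d : ℕ × Finset (Finset ℕ) → Γ → Bool := fun p γ => decide (cellCode E p.1 γ ∈ p.2)
  refine ⟨range d, countable_range d, dense_iff_inter_open.2 fun O hO ⟨x, hx⟩ => ?_⟩
  obtain ⟨F, hF⟩ := exists_cylinder_subset hO hx
  obtain ⟨m, hm⟩ := exists_cellCode_injOn hE F
  refine ⟨_, hF fun γ hγ => ?_,
    mem_range_self (m, (F.filter fun γ => x γ = true).image (cellCode E m))⟩
  have : cellCode E m γ ∈ (F.filter fun γ => x γ = true).image (cellCode E m) ↔ x γ = true := by
    simp only [Finset.mem_image, Finset.mem_filter]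
    constructor
    · rintro ⟨γ', ⟨h1, h2⟩, h3⟩
      rwa [← hm h1 hγ h3]
    · exact fun h => ⟨γ, ⟨hγ, h⟩, rfl⟩
  simp only [d, this, Bool.decide_eq_true, mem_singleton_iff]

end Cells

/-! ### Oscillation of a function along a set of coordinates -/

/-- The function `f` changes by at most `c` when its argument is modified only at coordinates
in `I`. -/
def OscLE {Γ : Type*} (f : C(Γ → Bool, ℝ)) (I : Set Γ) (c : ℝ) : Prop :=
  ∀ x y : Γ → Bool, (∀ γ ∉ I, x γ = y γ) → |f x - f y| ≤ c

section Oscillation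

variable {Γ : Type*} {f : C(Γ → Bool, ℝ)} {I J : Set Γ} {c d : ℝ}

theorem OscLE.mono (h : OscLE f I c) (hJ : J ⊆ I) (hc : c ≤ d) : OscLE f J d :=
  fun x y hxy => (h x y fun γ hγ => hxy γ fun h => hγ (hJ h)).trans hc

theorem OscLE.union (hI : OscLE f I c) (hJ : OscLE f J d) : OscLE f (I ∪ J) (c + d) := by
  classical
  intro x y hxy
  have h1 := hI x (I.piecewise y x) fun γ hγ => by simp [hγ]
  have h2 := hJ (I.piecewise y x) y fun γ hγ => by
    by_cases h : γ ∈ I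
    · simp [h]
    · simpa [h] using hxy γ (by simp [h, hγ])
  exact (abs_sub_le _ _ _).trans (add_le_add h1 h2)

theorem OscLE.biUnion {ι : Type*} {s : Finset ι} {I : ι → Set Γ} (h : ∀ i ∈ s, OscLE f (I i) c) :
    OscLE f (⋃ i ∈ s, I i) (s.card * c) := by
  classical
  induction s using Finset.induction_on with
  | empty =>
    intro x y hxy
    rw [funext fun γ => hxy γ (by simp)]
    simp
  | insert i s hi ih =>
    rw [Finset.set_biUnion_insert, Finset.card_insert_of_notMem hi]
    refine ((h i (Finset.mem_insert_self _ _)).union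
      (ih fun j hj => h j (Finset.mem_insert_of_mem hj))).mono subset_rfl ?_
    push_cast
    linarith

theorem OscLE.of_forall_add (h : ∀ δ > 0, OscLE f I (c + δ)) : OscLE f I c :=
  fun x y hxy => le_of_forall_pos_le_add fun δ hδ => h δ hδ x y hxy

/-- A continuous function on a Cantor cube is determined up to a small error by finitely many
coordinates. -/
theorem exists_finset_oscLE_compl (f : C(Γ → Bool, ℝ)) {ε : ℝ} (hε : 0 < ε) :
    ∃ F : Finset Γ, OscLE f (F : Set Γ)ᶜ ε := by
  classical
  have : ∀ x : Γ → Bool, ∃ F : Finset Γ,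
      (F : Set Γ).pi (fun γ => {x γ}) ⊆ f ⁻¹' Metric.ball (f x) (ε / 2) := fun x =>
    exists_cylinder_subset (Metric.isOpen_ball.preimage f.continuous)
      (Metric.mem_ball_self (half_pos hε))
  choose F hF using this
  obtain ⟨t, -, ht⟩ := (isCompact_univ (X := Γ → Bool)).elim_nhds_subcover
    (fun x => (F x : Set Γ).pi fun γ => {x γ})
    fun x _ => (isOpen_cylinder _ _).mem_nhds fun _ _ => rfl
  refine ⟨t.biUnion F, fun x y hxy => ?_⟩
  obtain ⟨z, hz, hxz⟩ := mem_iUnion₂.1 (ht (mem_univ x))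
  have hyz : y ∈ (F z : Set Γ).pi fun γ => {z γ} := fun γ hγ => by
    rw [← hxy γ fun h => h (Finset.mem_coe.2 (Finset.mem_biUnion.2 ⟨z, hz, hγ⟩))]
    exact hxz γ hγ
  have h1 := hF z hxz
  have h2 := hF z hyz
  rw [mem_preimage, Metric.mem_ball] at h1 h2
  rw [← Real.dist_eq]
  linarith [dist_triangle_right (f x) (f y) (f z)]

/-- In a separable Cantor cube, the oscillation along *any* set of coordinates is determined
by the values at countably many points. -/
theorem measurableSet_oscLE [SeparableSpace (Γ → Bool)] {m : MeasurableSpace C(Γ → Bool, ℝ)}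
    (hev : ∀ x, Measurable[m] fun f : C(Γ → Bool, ℝ) => f x) (I : Set Γ) (c : ℝ) :
    MeasurableSet[m] {f | OscLE f I c} := by
  classical
  let D := denseSeq (Γ → Bool)
  have : {f | OscLE f I c} = ⋂ (i : ℕ) (j : ℕ) (k : ℕ),
      {f : C(Γ → Bool, ℝ) | |f (I.piecewise (D i) (D k)) - f (I.piecewise (D j) (D k))| ≤ c} := by
    ext f
    simp only [mem_iInter, mem_ofPred_eq]
    refine ⟨fun h i j k => h _ _ fun γ hγ => by simp [hγ], fun h x y hxy => ?_⟩
    have key := (denseRange_denseSeq (Γ → Bool)).induction_on₃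
      (p := fun x y z => |f (I.piecewise x z) - f (I.piecewise y z)| ≤ c) ?_ h x y x
    · have hx : I.piecewise x x = x := by ext; simp
      have hy : I.piecewise y x = y := by
        ext γ
        by_cases hγ : γ ∈ I
        · simp [hγ]
        · simp [hγ, hxy γ hγ]
      simpa only [hx, hy] using key
    · refine isClosed_le ?_ continuous_const
      have hpw : ∀ {g h : (Γ → Bool) × (Γ → Bool) × (Γ → Bool) → Γ → Bool}, Continuous g →
          Continuous h → Continuous fun p => f (I.piecewise (g p) (h p)) := by
        intro g h hg hh
        refine f.continuous.comp (continuous_pi fun γ => ?_)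
        by_cases hγ : γ ∈ I
        · simp only [piecewise, hγ, if_true]
          fun_prop
        · simp only [piecewise, hγ, if_false]
          fun_prop
      exact ((hpw continuous_fst (by fun_prop)).sub (hpw (by fun_prop) (by fun_prop))).abs
  rw [this]
  refine MeasurableSet.iInter fun i => MeasurableSet.iInter fun j => MeasurableSet.iInter fun k => ?_
  exact measurableSet_le ((hev _).sub (hev _)).abs measurable_const

end Oscillation

/-! ### Isolating a single coordinate -/

/-- The set `W` isolates a coordinate of `f` at scale `η`: the oscillation of `f` along `W` exceeds
`2 * η`, but becomes at most `η` once a suitable `γ ∈ W` is removed from `W`. -/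
def Isolates {Γ : Type*} (W : Set Γ) (η : ℝ) (f : C(Γ → Bool, ℝ)) : Prop :=
  ¬OscLE f W (2 * η) ∧ ∃ γ ∈ W, OscLE f (W \ {γ}) η

section Isolation

variable {Γ : Type*} {f : C(Γ → Bool, ℝ)} {W : Set Γ} {η : ℝ}

/-- Removing `B` from `W` lowers the oscillation if and only if `B` contains the isolated
coordinate, which is therefore unique. -/
theorem mem_iff_oscLE_diff (hW : ¬OscLE f W (2 * η)) {γ : Γ} (h : OscLE f (W \ {γ}) η)
    {B : Set Γ} : γ ∈ B ↔ OscLE f (W \ B) η := by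
  refine ⟨fun hB => h.mono (sdiff_subset_sdiff_right (singleton_subset_iff.2 hB)) le_rfl,
    fun hB => ?_⟩
  by_contra hγ
  refine hW ((hB.union h).mono (fun x hx => ?_) (two_mul η).ge)
  by_cases hxγ : x = γ
  · exact Or.inl ⟨hx, hxγ ▸ hγ⟩
  · exact Or.inr ⟨hx, hxγ⟩

/-- An isolated coordinate is detected by the cells of a countable separating family. The cells
carrying the oscillation along `W` are nested, as two disjoint sets cannot both carry it; since `f`
depends essentially on finitely many coordinates, they shrink to an actual coordinate. -/
theorem isolates_iff {E : ℕ → Set Γ} (hE : ∀ a b, (∀ k, a ∈ E k ↔ b ∈ E k) → a = b)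
    (hη : 0 < η) : Isolates W η f ↔
      ¬OscLE f W (2 * η) ∧ ∀ m, ∃ σ, OscLE f (W \ cellCode E m ⁻¹' {σ}) η := by
  constructor
  · rintro ⟨hW, γ, -, hγ⟩
    exact ⟨hW, fun m => ⟨cellCode E m γ, (mem_iff_oscLE_diff hW hγ).1 rfl⟩⟩
  rintro ⟨hW, hσ⟩
  choose σ hσ using hσ
  -- Otherwise the two cells would be disjoint in `W`, and `W` would have oscillation at most `2 * η`.
  have hnest : ∀ {m m'}, m ≤ m' → ∀ {γ}, cellCode E m' γ = σ m' → cellCode E m γ = σ m := by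
    intro m m' hm γ hγ
    obtain ⟨γ', h1, h2⟩ : ∃ γ', cellCode E m γ' = σ m ∧ cellCode E m' γ' = σ m' := by
      by_contra! hne
      refine hW (((hσ m).union (hσ m')).mono (fun x hx => ?_) (two_mul η).ge)
      by_cases hx' : cellCode E m x = σ m
      · exact Or.inr ⟨hx, hne x hx'⟩
      · exact Or.inl ⟨hx, hx'⟩
    rw [← h1]
    exact cellCode_eq_of_le hm (hγ.trans h2.symm)
  -- From some level on, the selected cells meet `F` only in the intersection of all of them.
  have hfin : ∀ F : Finset Γ, ∃ m, ∀ γ ∈ F, cellCode E m γ = σ m → ∀ k, cellCode E k γ = σ k := by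
    intro F
    have : ∀ γ, ∃ k, cellCode E k γ = σ k → ∀ k, cellCode E k γ = σ k := by
      intro γ
      by_contra! h
      obtain ⟨k, hk⟩ := (h 0).2
      exact hk (h k).1
    choose k hk using this
    exact ⟨F.sup k, fun γ hγ h => hk γ (hnest (Finset.le_sup hγ) h)⟩
  have hlim : ∃ γ ∈ W, ∀ k, cellCode E k γ = σ k := by
    obtain ⟨F, hF⟩ := exists_finset_oscLE_compl f hη
    obtain ⟨m, hm⟩ := hfin F
    by_contra! h
    refine hW (((hσ m).union hF).mono (fun x hx => ?_) (two_mul η).ge)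
    by_cases hxF : x ∈ F
    · obtain ⟨k, hk⟩ := h x hx
      exact Or.inl ⟨hx, fun hxm => hk (hm x hxF hxm k)⟩
    · exact Or.inr hxF
  obtain ⟨γ, hγW, hγ⟩ := hlim
  refine ⟨hW, γ, hγW, OscLE.of_forall_add fun δ hδ => ?_⟩
  obtain ⟨F, hF⟩ := exists_finset_oscLE_compl f hδ
  obtain ⟨m, hm⟩ := hfin F
  refine ((hσ m).union hF).mono (fun x hx => ?_) le_rfl
  by_cases hxF : x ∈ F
  · refine Or.inl ⟨hx.1, fun hxm => hx.2 (hE x γ fun k => ?_)⟩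
    exact cellCode_eq_iff.1 ((hm x hxF hxm (k + 1)).trans (hγ _).symm) k k.lt_succ_self
  · exact Or.inr hxF

/-- The coordinate of `f` isolated by `W` at scale `η`, with an arbitrary value if there is none. -/
noncomputable def isolatedCoord [Nonempty Γ] (W : Set Γ) (η : ℝ) (f : C(Γ → Bool, ℝ)) : Γ :=
  open Classical in
  if h : Isolates W η f then h.2.choose else Classical.arbitrary Γ

theorem Isolates.isolatedCoord_spec [Nonempty Γ] (h : Isolates W η f) :
    OscLE f (W \ {isolatedCoord W η f}) η := by
  rw [isolatedCoord, dif_pos h]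
  exact h.2.choose_spec.2

theorem Isolates.isolatedCoord_mem [Nonempty Γ] (h : Isolates W η f) :
    isolatedCoord W η f ∈ W := by
  rw [isolatedCoord, dif_pos h]
  exact h.2.choose_spec.1

variable {m : MeasurableSpace C(Γ → Bool, ℝ)}

theorem measurableSet_isolates (hev : ∀ x, Measurable[m] fun f : C(Γ → Bool, ℝ) => f x)
    {E : ℕ → Set Γ} (hE : ∀ a b, (∀ k, a ∈ E k ↔ b ∈ E k) → a = b) (W : Set Γ) (hη : 0 < η) :
    MeasurableSet[m] {f | Isolates W η f} := by
  have := separableSpace_pi_bool hE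
  simp only [isolates_iff hE hη, ofPred_and, ofPred_forall, ofPred_exists]
  exact (measurableSet_oscLE hev _ _).compl.inter
    (MeasurableSet.iInter fun _ => MeasurableSet.iUnion fun _ => measurableSet_oscLE hev _ _)

theorem measurable_isolatedCoord [Nonempty Γ]
    (hev : ∀ x, Measurable[m] fun f : C(Γ → Bool, ℝ) => f x) {E : ℕ → Set Γ}
    (hE : ∀ a b, (∀ k, a ∈ E k ↔ b ∈ E k) → a = b) (W : Set Γ) (hη : 0 < η) :
    Measurable[m, ⊤] (isolatedCoord W η : C(Γ → Bool, ℝ) → Γ) := by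
  have := separableSpace_pi_bool hE
  intro B _
  have : isolatedCoord W η ⁻¹' B = {f : C(Γ → Bool, ℝ) | Isolates W η f} ∩ {f | OscLE f (W \ B) η} ∪
      {f | Isolates W η f}ᶜ ∩ {_f | Classical.arbitrary Γ ∈ B} := by
    ext f
    by_cases h : Isolates W η f
    · simp [h, mem_iff_oscLE_diff h.1 h.isolatedCoord_spec (B := B)]
    · simp [h, isolatedCoord]
  rw [this]
  exact ((measurableSet_isolates hev hE W hη).inter (measurableSet_oscLE hev _ _)).union
    ((measurableSet_isolates hev hE W hη).compl.inter (MeasurableSet.const _))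

end Isolation

/-! ### Approximation by functions of finitely many coordinates -/

section Approximation

variable {Γ : Type*} {n : ℕ}

/-- The function `x ↦ q (x (γ 0), …, x (γ (n - 1)))` on the Cantor cube. -/
def finiteCoordFun (γ : Fin n → Γ) (q : (Fin n → Bool) → ℚ) : C(Γ → Bool, ℝ) where
  toFun x := q fun i => x (γ i)
  continuous_toFun := (continuous_of_discreteTopology (f := fun e : Fin n → Bool => (q e : ℝ))).comp
    (continuous_pi fun i => continuous_apply (γ i))

/-- The point of the Cantor cube taking the value `e i` on the cell of code `σ i`, and `false`
outside these cells. -/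
noncomputable def cellPoint (E : ℕ → Set Γ) (m : ℕ) (σ : Fin n → Finset ℕ) (e : Fin n → Bool) :
    Γ → Bool :=
  open Classical in fun γ => decide (∃ i, cellCode E m γ = σ i ∧ e i = true)

/-- Up to `ε` the function `f` depends only on the coordinates in the cells of codes `σ i`, each of
these `n` cells isolates a coordinate of `f` at scale `η`, and `q` approximates up to `ε` the values
of `f` at the points that are constant on the cells. -/
structure IsApproxData (E : ℕ → Set Γ) (ε η : ℝ) (m : ℕ) (σ : Fin n → Finset ℕ)
    (q : (Fin n → Bool) → ℚ) (f : C(Γ → Bool, ℝ)) : Prop where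
  oscLE : OscLE f (⋃ i, cellCode E m ⁻¹' {σ i})ᶜ ε
  isolates : ∀ i, Isolates (cellCode E m ⁻¹' {σ i}) η f
  approx : ∀ e, |f (cellPoint E m σ e) - q e| ≤ ε

variable {E : ℕ → Set Γ} {ε η : ℝ} {m : ℕ} {σ : Fin n → Finset ℕ} {q : (Fin n → Bool) → ℚ}

/-- Replacing `x` by the point that is constant on the cells and agrees with `x` at the isolated
coordinates changes `f` by at most `ε + n * η`; the values at such points are known up to `ε`. -/
theorem IsApproxData.dist_finiteCoordFun_le [Nonempty Γ] {f : C(Γ → Bool, ℝ)}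
    (h : IsApproxData E ε η m σ q f) (hσ : Function.Injective σ) (hε : 0 ≤ ε) (hη : n * η ≤ ε) :
    dist f (finiteCoordFun (fun i => isolatedCoord (cellCode E m ⁻¹' {σ i}) η f) q) ≤ 3 * ε := by
  set γ : Fin n → Γ := fun i => isolatedCoord (cellCode E m ⁻¹' {σ i}) η f with hγ
  have hmem : ∀ i, cellCode E m (γ i) = σ i := fun i => (h.isolates i).isolatedCoord_mem
  have hosc : OscLE f (range γ)ᶜ (2 * ε) := by
    have h1 := OscLE.biUnion (s := Finset.univ) fun i _ => (h.isolates i).isolatedCoord_spec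
    refine (h.oscLE.union h1).mono (fun x hx => ?_) (by simpa [two_mul] using hη)
    by_cases hxW : x ∈ ⋃ i, cellCode E m ⁻¹' {σ i}
    · obtain ⟨i, hi⟩ := mem_iUnion.1 hxW
      exact Or.inr (mem_iUnion₂.2 ⟨i, Finset.mem_univ i, hi, fun hxi => hx ⟨i, hxi.symm⟩⟩)
    · exact Or.inl hxW
  refine (ContinuousMap.dist_le (by positivity)).2 fun x => ?_
  have h1 := hosc x (cellPoint E m σ fun i => x (γ i)) (by
    intro g hg
    obtain ⟨i, rfl⟩ := not_not.1 hg
    simp [cellPoint, hmem, hσ.eq_iff])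
  have h2 := h.approx fun i => x (γ i)
  rw [Real.dist_eq]
  change |f x - (q fun i => x (γ i) : ℝ)| ≤ 3 * ε
  linarith [abs_sub_le (f x) (f (cellPoint E m σ fun i => x (γ i))) (q fun i => x (γ i) : ℝ)]

/-- Every continuous function has approximation data of arbitrary precision: choose finitely many
essential coordinates, then `η` small relative to their number and to the oscillations along each
of them, and finally cells so small that the rest of each cell has oscillation at most `η`. -/
theorem exists_isApproxData (hE : ∀ a b, (∀ k, a ∈ E k ↔ b ∈ E k) → a = b) (f : C(Γ → Bool, ℝ))
    (hε : 0 < ε) : ∃ (n M m : ℕ) (σ : Fin n → Finset ℕ) (q : (Fin n → Bool) → ℚ),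
      Function.Injective σ ∧ n * (1 / ((M : ℝ) + 1)) ≤ ε ∧
        IsApproxData E ε (1 / ((M : ℝ) + 1)) m σ q f := by
  classical
  obtain ⟨F₀, hF₀⟩ := exists_finset_oscLE_compl f hε
  -- Coordinates of vanishing oscillation may be dropped at no cost.
  set F := F₀.filter fun γ => ¬OscLE f {γ} 0 with hFdef
  have hF : OscLE f (F : Set Γ)ᶜ ε := by
    have h1 := OscLE.biUnion (f := f) (s := F₀.filter fun γ => OscLE f {γ} 0) (I := fun γ => {γ})
      (c := 0) fun γ hγ => (Finset.mem_filter.1 hγ).2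
    refine (hF₀.union h1).mono (fun γ hγ => ?_) (by simp)
    by_cases h : γ ∈ F₀
    · refine Or.inr (mem_iUnion₂.2 ⟨γ, Finset.mem_filter.2 ⟨h, ?_⟩, rfl⟩)
      by_contra h'
      exact hγ (Finset.mem_coe.2 (Finset.mem_filter.2 ⟨h, h'⟩))
    · exact Or.inl h
  have hlim := tendsto_one_div_add_atTop_nhds_zero_nat (𝕜 := ℝ)
  have hM1 : ∀ᶠ M : ℕ in atTop, ∀ γ ∈ F, ¬OscLE f {γ} (2 * (1 / ((M : ℝ) + 1))) := by
    refine (eventually_all_finset F).2 fun γ hγ => ?_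
    have hosc := (Finset.mem_filter.1 hγ).2
    simp only [OscLE, not_forall, not_le] at hosc
    obtain ⟨x, y, hxy, hlt⟩ := hosc
    have h2 := hlim.const_mul 2
    rw [mul_zero] at h2
    filter_upwards [h2.eventually_lt_const hlt] with M hM h
    exact (h x y hxy).not_gt hM
  have hM2 : ∀ᶠ M : ℕ in atTop, (F.card : ℝ) * (1 / ((M : ℝ) + 1)) < ε := by
    have h2 := hlim.const_mul (F.card : ℝ)
    rw [mul_zero] at h2
    exact h2.eventually_lt_const hε
  obtain ⟨M, hM1, hM2⟩ := (hM1.and hM2).exists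
  set η : ℝ := 1 / ((M : ℝ) + 1) with hη
  obtain ⟨F₁, hF₁⟩ := exists_finset_oscLE_compl f (show 0 < η by positivity)
  obtain ⟨m, hm⟩ := exists_cellCode_injOn hE (F ∪ F₁)
  let γ : Fin F.card → Γ := fun i => F.equivFin.symm i
  have hγF : ∀ i, γ i ∈ F := fun i => (F.equivFin.symm i).2
  have hγ : Function.Injective γ := Subtype.val_injective.comp F.equivFin.symm.injective
  have hq : ∀ e, ∃ q : ℚ, |f (cellPoint E m (fun i => cellCode E m (γ i)) e) - q| ≤ ε := by
    intro e
    obtain ⟨q, hq⟩ := exists_rat_near (f (cellPoint E m (fun i => cellCode E m (γ i)) e)) hε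
    exact ⟨q, hq.le⟩
  choose q hq using hq
  refine ⟨F.card, M, m, fun i => cellCode E m (γ i), q, fun i j hij => ?_, hM2.le, ?_, ?_, hq⟩
  · exact hγ (hm (Finset.mem_union_left _ (hγF i)) (Finset.mem_union_left _ (hγF j)) hij)
  · refine hF.mono (compl_subset_compl.2 fun g hg => ?_) le_rfl
    exact mem_iUnion.2 ⟨F.equivFin ⟨g, hg⟩, by simp [γ]⟩
  · refine fun i => ⟨fun h => hM1 _ (hγF i) (h.mono (singleton_subset_iff.2 rfl) le_rfl),
      γ i, rfl, hF₁.mono (fun g hg hgF => hg.2 ?_) le_rfl⟩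
    exact hm (Finset.mem_union_right _ hgF) (Finset.mem_union_left _ (hγF i)) hg.1

theorem measurableSet_isApproxData {mΩ : MeasurableSpace C(Γ → Bool, ℝ)}
    (hev : ∀ x, Measurable[mΩ] fun f : C(Γ → Bool, ℝ) => f x)
    (hE : ∀ a b, (∀ k, a ∈ E k ↔ b ∈ E k) → a = b) (hη : 0 < η) :
    MeasurableSet[mΩ] {f | IsApproxData E ε η m σ q f} := by
  have := separableSpace_pi_bool hE
  have : {f | IsApproxData E ε η m σ q f} = {f | OscLE f (⋃ i, cellCode E m ⁻¹' {σ i})ᶜ ε} ∩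
      ((⋂ i, {f | Isolates (cellCode E m ⁻¹' {σ i}) η f}) ∩
        ⋂ e, {f | |f (cellPoint E m σ e) - q e| ≤ ε}) := by
    ext f
    simp only [mem_inter_iff, mem_iInter, mem_ofPred_eq]
    exact ⟨fun h => ⟨h.1, h.2, h.3⟩, fun h => ⟨h.1, h.2.1, h.2.2⟩⟩
  rw [this]
  refine (measurableSet_oscLE hev _ _).inter
    ((MeasurableSet.iInter fun i => measurableSet_isolates hev hE _ hη).inter
      (MeasurableSet.iInter fun e => ?_))
  exact measurableSet_le ((hev _).sub measurable_const).abs measurable_const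

end Approximation

/-! ### Borel sets and Baire sets of `C(2^Γ)` -/

/-- If all subsets of `Γ × Γ` belong to the product `σ`-algebra, then a `σ`-algebra on `C(2^Γ)`
making the evaluations measurable contains all norm-open sets. An open set is a countable union of
sets given by approximation data and by a condition on the tuple of isolated coordinates. -/
theorem measurableSet_of_isOpen_of_measurable_eval {Γ : Type*} [Infinite Γ]
    (h : MeasurableSpace.generateFrom {S : Set (Γ × Γ) | ∃ A B : Set Γ, S = A ×ˢ B} = ⊤)
    {mΩ : MeasurableSpace C(Γ → Bool, ℝ)}
    (hev : ∀ x, Measurable[mΩ] fun f : C(Γ → Bool, ℝ) => f x)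
    {U : Set C(Γ → Bool, ℝ)} (hU : IsOpen U) : MeasurableSet[mΩ] U := by
  obtain ⟨E, hE⟩ := exists_separating_of_generateFrom_prod_eq_top h
  let ε : ℕ → ℝ := fun N => 1 / ((N : ℝ) + 1)
  have hε : ∀ N, 0 < ε N := fun N => by positivity
  -- Data of precision `ε` yield an approximation of `f` within `3 * ε`, so its ball of radius
  -- `4 * ε` contains `f` and lies in the ball of radius `7 * ε` around `f`.
  have key : U = ⋃ (N : ℕ) (n : ℕ) (M : ℕ) (m : ℕ) (σ : Fin n → Finset ℕ)
      (q : (Fin n → Bool) → ℚ) (_ : Function.Injective σ ∧ n * ε M ≤ ε N),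
      {f | IsApproxData E (ε N) (ε M) m σ q f} ∩
        (fun f i => isolatedCoord (cellCode E m ⁻¹' {σ i}) (ε M) f) ⁻¹'
          {γ | Metric.ball (finiteCoordFun γ q) (4 * ε N) ⊆ U} := by
    ext f
    simp only [mem_iUnion]
    constructor
    · intro hf
      obtain ⟨r, hr, hball⟩ := Metric.isOpen_iff.1 hU f hf
      obtain ⟨N, hN⟩ := exists_nat_one_div_lt (show 0 < r / 7 by positivity)
      obtain ⟨n, M, m, σ, q, hσ, hM, hdata⟩ := exists_isApproxData hE f (hε N)
      refine ⟨N, n, M, m, σ, q, ⟨hσ, hM⟩, hdata, fun g hg => hball ?_⟩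
      have h1 := hdata.dist_finiteCoordFun_le hσ (hε N).le hM
      rw [Metric.mem_ball, dist_comm] at hg ⊢
      change ε N < r / 7 at hN
      refine (dist_triangle _ _ _).trans_lt ((add_lt_add_of_le_of_lt h1 hg).trans ?_)
      linarith
    · rintro ⟨N, n, M, m, σ, q, ⟨hσ, hM⟩, hdata, hsub⟩
      refine hsub (Metric.mem_ball.2 ((hdata.dist_finiteCoordFun_le hσ (hε N).le hM).trans_lt ?_))
      linarith [hε N]
  rw [key]
  refine MeasurableSet.iUnion fun N => MeasurableSet.iUnion fun n => MeasurableSet.iUnion fun M =>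
    MeasurableSet.iUnion fun m => MeasurableSet.iUnion fun σ =>
    MeasurableSet.iUnion fun q => MeasurableSet.iUnion fun _ =>
      (measurableSet_isApproxData hev hE (hε M)).inter ?_
  exact measurable_pi_top h (fun i => measurable_isolatedCoord hev hE _ (hε M)) trivial

theorem baireCp_eq_borelC_of_generateFrom_prod_eq_top (Γ : Type u) [Infinite Γ]
    (h : MeasurableSpace.generateFrom {S : Set (Γ × Γ) | ∃ A B : Set Γ, S = A ×ˢ B} = ⊤) :
    baireCp (Γ → Bool) = borelC (Γ → Bool) := by
  apply le_antisymm
  · refine iSup_le fun ⟨g, hg⟩ => ?_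
    rintro _ ⟨B, hB, rfl⟩
    revert B
    change borel ℝ ≤ MeasurableSpace.map g (borelC (Γ → Bool))
    refine MeasurableSpace.generateFrom_le fun V hV => MeasurableSpace.measurableSet_generateFrom ?_
    have hle : Continuous[supNormTopology (Γ → Bool), pointwiseTopology (Γ → Bool)] id :=
      continuous_induced_rng.2 (continuous_pi fun x => continuous_eval_const x)
    exact hV.preimage (@Continuous.comp _ _ _ _ (pointwiseTopology _) _ _ _ hg hle)
  · refine MeasurableSpace.generateFrom_le fun U hU => ?_
    refine measurableSet_of_isOpen_of_measurable_eval h (fun x => ?_) hU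
    rw [measurable_iff_comap_le]
    rw [BorelSpace.measurable_eq (α := ℝ)]
    exact le_iSup_of_le ⟨fun f : C(Γ → Bool, ℝ) => f x, @Continuous.comp _ _ _
      (pointwiseTopology _) _ _ _ _ (continuous_apply x) continuous_induced_dom⟩ le_rfl

theorem mainTheorem1 (Γ : Type u) [Infinite Γ] :
    List.TFAE [
      IsKunenCardinal (Cardinal.mk Γ),
      baireCp (Γ → Bool) = borelC (Γ → Bool),
      traceSigmaAlgebra (baireCp (Γ → Bool)) (zeroOneFunctions (Γ → Bool)) = ⊤,
      ultrafilterSigmaAlgebra (TopologicalSpace.Clopens (Γ → Bool)) = ⊤] := by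
  tfae_have 1 → 2 := fun h =>
    baireCp_eq_borelC_of_generateFrom_prod_eq_top Γ ((isKunenCardinal_mk_iff Γ).1 h)
  tfae_have 2 → 3 := trace_eq_top_of_baireCp_eq_borelC _
  tfae_have 3 → 4 := ultrafilterSigmaAlgebra_eq_top_of_trace_eq_top _
  tfae_have 4 → 1 := fun h => (isKunenCardinal_mk_iff Γ).2
    (generateFrom_prod_eq_top_of_ultrafilterSigmaAlgebra_eq_top Γ h)
  tfae_finish
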